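/- Let $\mathcal C$ be a field of characteristic zero, let $\sigma_x,\sigma_y$ be the shift operators $x\mapsto x+1$ and $y\mapsto y+1$ on $\mathcal C(x,y)$, and let $\mathbb D$ be a partial difference ring extension of $(\mathcal C(x,y),\{\sigma_x,\sigma_y\})$, i.e. a ring containing $\mathcal C(x,y)$ with two commuting ring endomorphisms, again denoted $\sigma_x,\sigma_y$, that extend the shift operators. Put $\Delta_y=\sigma_y-1$. A hypergeometric term is a nonzero $T\in\mathbb D$ with $\sigma_x(T)=fT$ and $\sigma_y(T)=gT$ for some $f,g\in\mathcal C(x,y)$. Let $T=SH$, where $T,H\in\mathbb D$ are hypergeometric terms, $S\in\mathcal C(x,y)$, and $\sigma_y(H)=KH$ with $K\in\mathcal C(x,y)$ shift-reduced with respect to $y$, i.e. $K$ is nonzero and its numerator is coprime with $\sigma_y^i$ of its denominator for all $i\in\mathbb Z$ (as polynomials in $\mathcal C(x)[y]$). Write $K=u/v$ with $u,v\in\mathcal C(x)[y]$, $\gcd(u,v)=1$. A nonzero $p\in\mathcal C(x)[y]$ is called shift-free in $y$ if no two distinct roots of $p$ (in an algebraic closure of $\mathcal C(x)$) differ by an integer,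 and strongly prime with $K$ if $\gcd(p,\sigma_y^{-i}(u))=\gcd(p,\sigma_y^{i}(v))=1$ for all integers $i\ge 0$. Let $\phi_K(p)=u\,\sigma_y(p)-v\,p$ for $p\in\mathcal C(x)[y]$, and let $$\mathbb W_K=\operatorname{span}_{\mathcal C(x)}\{\,y^\ell \mid \ell\in\mathbb N,\ \ell\ne\deg_y(p)\text{ for all nonzero } p\in\operatorname{im}\phi_K\,\}.$$ A polynomial in $\mathcal C[x,y]$ is integer-linear if each of its irreducible factors has the form $P(\lambda x+\mu y)$ with $P\in\mathcal C[z]$ and $\lambda,\mu\in\mathbb Z$; an element of $\mathcal C(x,y)$ is integer-linear if its numerator and its denominator (coprime polynomials in $\mathcal C[x,y]$) are. Assume that $$T=\Delta_y(gH)+\Bigl(\frac ab+\frac qv\Bigr)H,$$ where $g\in\mathcal C(x,y)$, $a,b\in\mathcal C(x)[y]$, $\deg_y a<\deg_y b$, $\gcd(a,b)=1$, $b$ is shift-free in $y$ and strongly prime with $K$, and $q\in\mathbb W_K$. Assume moreover that $b$ is integer-linear. Then there is a polynomial $B\in\mathcal C(x)[y]$, shift-free in $y$ and strongly prime with $K$,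 such that $b\mid B$ and, for every integer $i\ge 0$, $$\sigma_x^i(T)=\Delta_y(g_iH)+\Bigl(\frac{a_i}{B}+\frac{q_i}{v}\Bigr)H$$ for some $g_i\in\mathcal C(x,y)$, $a_i\in\mathcal C(x)[y]$ with $\deg_y a_i<\deg_y B$, and $q_i\in\mathbb W_K$. Moreover, for every choice of such decompositions, one for each $i\ge 0$, the rational functions $a_i/B+q_i/v$ $(i\ge 0)$ span a finite-dimensional vector space over $\mathcal C(x)$. (Here $\deg_y 0=-\infty$.) -/

import Mathlib

open Polynomial

noncomputable section

namespace HypergeomReduction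

/-! ### Shift operators on rational functions -/

section RationalFunctions

/-- The endomorphism `f(X) ↦ f(X + 1)` of the rational function field `K(X)`. -/
def shiftVar (K : Type*) [Field K] : RatFunc K →+* RatFunc K :=
  RatFunc.mapRingHom (taylorAlgHom (1 : K)).toRingHom
    (nonZeroDivisors_le_comap_nonZeroDivisors_of_injective _ (taylor_injective (1 : K)))

/-- The endomorphism of `K(X)` that applies a field endomorphism `φ` of `K` to all
coefficients and fixes `X`. -/
def mapCoeff {K : Type*} [Field K] (φ : K →+* K) : RatFunc K →+* RatFunc K :=
  RatFunc.mapRingHom (Polynomial.mapRingHom φ)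
    (nonZeroDivisors_le_comap_nonZeroDivisors_of_injective _
      (Polynomial.map_injective φ φ.injective))

/-- The field `k(x, y)`, realised as `k(x)(y)`. -/
abbrev RatXY (k : Type*) [Field k] : Type _ := RatFunc (RatFunc k)

/-- `σ_x : f(x, y) ↦ f(x + 1, y)` on `k(x, y)`. -/
def sigmaX (k : Type*) [Field k] : RatXY k →+* RatXY k := mapCoeff (shiftVar k)

/-- `σ_y : f(x, y) ↦ f(x, y + 1)` on `k(x, y)`. -/
def sigmaY (k : Type*) [Field k] : RatXY k →+* RatXY k := shiftVar (RatFunc k)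

end RationalFunctions

/-! ### Polynomials and rational functions in `y` over a field `F` -/

section Univariate

variable {F : Type*} [Field F]

/-- `σ_y ^ i`, for an integer `i`, on `F[y]`: `p(y) ↦ p(y + i)`. -/
def shiftPow (i : ℤ) (p : F[X]) : F[X] := p.comp (X + C (i : F))

/-- A nonzero polynomial is shift-free if no two distinct roots (in an algebraic closure)
differ by an integer. -/
def IsShiftFree (p : F[X]) : Prop :=
  p ≠ 0 ∧ ∀ α β : AlgebraicClosure F, aeval α p = 0 → aeval β p = 0 →
    ∀ n : ℤ, α - β = (n : AlgebraicClosure F) → α = β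

/-- A nonzero rational function is shift-reduced if its numerator is coprime with every
shift of its denominator. -/
def IsShiftReduced (K : RatFunc F) : Prop :=
  K ≠ 0 ∧ ∀ i : ℤ, IsCoprime K.num (shiftPow i K.denom)

/-- A nonzero polynomial `p` is strongly prime with `K = u / v` (in lowest terms) if
`gcd(p, σ_y^{-i}(u)) = gcd(p, σ_y^i(v)) = 1` for all `i ≥ 0`. -/
def IsStronglyPrime (u v p : F[X]) : Prop :=
  p ≠ 0 ∧ ∀ i : ℕ, IsCoprime p (shiftPow (-(i : ℤ)) u) ∧ IsCoprime p (shiftPow (i : ℤ) v)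

/-- The map for polynomial reduction with respect to `K = u / v`:
`p ↦ u σ_y(p) - v p`. -/
def phi (u v p : F[X]) : F[X] := u * shiftPow 1 p - v * p

/-- The standard complement `W_K` of the image of `phi u v`: the span of the monomials
`y ^ l` such that `l` is not the degree of a (nonzero) polynomial in that image.
(The degree of `0` is `⊥`, which is different from every natural number.) -/
def standardComplement (u v : F[X]) : Submodule F F[X] :=
  Submodule.span F {m | ∃ l : ℕ, m = X ^ l ∧ ∀ p : F[X], (phi u v p).degree ≠ (l : WithBot ℕ)}

/-- The rational function `a / b + q / v`. -/
def remainder (v b a q : F[X]) : RatFunc F :=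
  algebraMap F[X] (RatFunc F) a / algebraMap F[X] (RatFunc F) b +
    algebraMap F[X] (RatFunc F) q / algebraMap F[X] (RatFunc F) v

end Univariate

/-! ### Integer-linearity -/

section IntegerLinear

variable {k : Type*} [Field k]

/-- A bivariate polynomial in `k[x, y] = k[x][y]` of the form `P(l x + m y)`, with
`P ∈ k[z]` and `l, m` integers. -/
def IsPolyOfIntegerForm (p : k[X][X]) : Prop :=
  ∃ (P : k[X]) (l m : ℤ), p = aeval ((l : k[X][X]) * C X + (m : k[X][X]) * X) P

/-- A polynomial in `k[x, y]` is integer-linear if each of its irreducible factors is of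
the form `P(l x + m y)`. -/
def IsIntegerLinearPoly (p : k[X][X]) : Prop :=
  ∀ f : k[X][X], Irreducible f → f ∣ p → IsPolyOfIntegerForm f

/-- The inclusion of `k[x, y]` in `k(x, y)`. -/
def polyToRatXY (k : Type*) [Field k] : k[X][X] →+* RatXY k :=
  (algebraMap (RatFunc k)[X] (RatXY k)).comp
    (Polynomial.mapRingHom (algebraMap k[X] (RatFunc k)))

/-- A rational function in `k(x, y)` is integer-linear if its numerator and its denominator,
which are coprime polynomials in `k[x, y]`, are both integer-linear. -/
def IsIntegerLinear (r : RatXY k) : Prop :=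
  ∃ n d : k[X][X], d ≠ 0 ∧ IsRelPrime n d ∧ r = polyToRatXY k n / polyToRatXY k d ∧
    IsIntegerLinearPoly n ∧ IsIntegerLinearPoly d

end IntegerLinear

/-! ### Hypergeometric terms -/

section Hypergeometric

/-- The structure, on a ring `D`, of a partial difference ring extension of
`(k(x, y), {σ_x, σ_y})`: `D` contains `k(x, y)`, and it carries two commuting ring
endomorphisms that restrict to the shift operators of `k(x, y)`. -/
structure PartialDifferenceExtension (k : Type*) [Field k] (D : Type*) [Ring D] where
  /-- the inclusion of `k(x, y)` in `D` -/
  incl : RatXY k →+* D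
  incl_injective : Function.Injective incl
  /-- `σ_x` on `D` -/
  sx : D →+* D
  /-- `σ_y` on `D` -/
  sy : D →+* D
  sx_sy : ∀ t : D, sx (sy t) = sy (sx t)
  sx_incl : ∀ f : RatXY k, sx (incl f) = incl (sigmaX k f)
  sy_incl : ∀ f : RatXY k, sy (incl f) = incl (sigmaY k f)

namespace PartialDifferenceExtension

variable {k : Type*} [Field k] {D : Type*} [Ring D] (E : PartialDifferenceExtension k D)

/-- `Δ_y(t) = σ_y(t) - t`. -/
def deltaY (t : D) : D := E.sy t - t

/-- A hypergeometric term over `k(x, y)` in `D`. -/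
def IsHypergeometric (T : D) : Prop :=
  T ≠ 0 ∧ ∃ f g : RatXY k, E.sx T = E.incl f * T ∧ E.sy T = E.incl g * T

/-- The term `t` has a decomposition `t = Δ_y(g H) + (a / b + q / v) H` for some rational
function `g`, where `deg_y a < deg_y b` and `q` belongs to `W_K`, `K = u / v`. -/
def HasRemainder (H : D) (u v b : (RatFunc k)[X]) (t : D) (a q : (RatFunc k)[X]) : Prop :=
  a.degree < b.degree ∧ q ∈ standardComplement u v ∧
    ∃ g : RatXY k, t = E.deltaY (E.incl g * H) + E.incl (remainder v b a q) * H

end PartialDifferenceExtension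

end Hypergeometric

end HypergeomReduction

end

namespace HypergeomReduction

/-! ### The integer shifts of polynomials -/

section Shift

variable {F : Type*} [Field F]

/-! Write `r = a/b + q/v` and `σ_x^i(H) = N_i H`. Then `σ_x^i(T)` is `σ_x^i(r) N_i H` up to a
`Δ_y`-image, so the problem concerns rational functions modulo `f ↦ K σ_y(f) - f`. It suffices to
control the denominators `denom(N_i) σ_x^i(v) σ_x^i(b)` uniformly in `i`.

Commutation of the shifts gives `σ_x^i(K)/K = σ_y(N_i)/N_i`. Telescoping this over long intervals of
`y`-shifts, with `K` shift-reduced, shows that `denom(N_i) σ_x^i(v)` divides a product of distinct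
`y`-shifts of `u v v` (`shiftDvd_denom`). Integer-linearity gives one polynomial `e` whose shifts
likewise absorb every `σ_x^i(b)`: on `P(λx + μy)`, `σ_x^|μ|` acts as a power of `σ_y`
(`IsIntegerLinear.exists_shiftDvd`).

`B` is obtained from `b` by adjoining a strongly prime representative of the shift class of each
irreducible factor of `u v v e`, with multiplicity (`exists_shiftFree_stronglyPrime_cover`). Strong
primeness moves any shift of `B` back to `B` at the cost of terms over `v`, and shift-freeness lets
partial fractions separate distinct shifts (`isReducibleDenom_of_shiftDvd`).

Finiteness holds because `deg a_i < deg B` and `W_K` is finite-dimensional: `φ_K` attains every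
sufficiently large degree (`exists_degree_phi_eq`). -/

theorem shiftPow_eq_taylor (i : ℤ) (p : F[X]) : shiftPow i p = taylor (i : F) p := rfl

@[simp] theorem shiftPow_zero (p : F[X]) : shiftPow 0 p = p := by simp [shiftPow]

@[simp] theorem shiftPow_one_right (i : ℤ) : shiftPow i (1 : F[X]) = 1 := by simp [shiftPow]

@[simp] theorem shiftPow_C (i : ℤ) (c : F) : shiftPow i (C c) = C c := by simp [shiftPow]

@[simp] theorem shiftPow_mul (i : ℤ) (p q : F[X]) :
    shiftPow i (p * q) = shiftPow i p * shiftPow i q := by simp [shiftPow]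

@[simp] theorem shiftPow_add_right (i : ℤ) (p q : F[X]) :
    shiftPow i (p + q) = shiftPow i p + shiftPow i q := by simp [shiftPow]

@[simp] theorem shiftPow_shiftPow (i j : ℤ) (p : F[X]) :
    shiftPow i (shiftPow j p) = shiftPow (i + j) p := by
  simp [shiftPow_eq_taylor, taylor_taylor]

@[simp] theorem shiftPow_eq_zero {i : ℤ} {p : F[X]} : shiftPow i p = 0 ↔ p = 0 :=
  taylor_eq_zero _ _

theorem shiftPow_ne_zero {i : ℤ} {p : F[X]} (hp : p ≠ 0) : shiftPow i p ≠ 0 :=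
  fun h => hp (shiftPow_eq_zero.1 h)

@[simp] theorem shiftPow_prod {ι : Type*} (i : ℤ) (s : Finset ι) (f : ι → F[X]) :
    shiftPow i (∏ j ∈ s, f j) = ∏ j ∈ s, shiftPow i (f j) :=
  map_prod (taylorAlgHom (i : F)) f s

theorem shiftPow_dvd_shiftPow {p q : F[X]} (i : ℤ) (h : p ∣ q) : shiftPow i p ∣ shiftPow i q := by
  obtain ⟨c, rfl⟩ := h
  exact ⟨shiftPow i c, shiftPow_mul i p c⟩

theorem isCoprime_shiftPow_shiftPow {i : ℤ} {p q : F[X]} :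
    IsCoprime (shiftPow i p) (shiftPow i q) ↔ IsCoprime p q := by
  have key : ∀ (i : ℤ) (p q : F[X]), IsCoprime p q → IsCoprime (shiftPow i p) (shiftPow i q) :=
    fun i p q h => h.map (taylorAlgHom (i : F)).toRingHom
  refine ⟨fun h => ?_, key i p q⟩
  simpa using key (-i) _ _ h

theorem isCoprime_shiftPow_iff {i j : ℤ} {p q : F[X]} :
    IsCoprime (shiftPow i p) (shiftPow j q) ↔ IsCoprime p (shiftPow (j - i) q) := by
  rw [← isCoprime_shiftPow_shiftPow (i := i) (p := p), shiftPow_shiftPow]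
  simp

theorem map_shiftPow {L : Type*} [Field L] (φ : F →+* L) (i : ℤ) (p : F[X]) :
    (shiftPow i p).map φ = shiftPow i (p.map φ) := by
  simp [shiftPow_eq_taylor]

theorem aeval_shiftPow {A : Type*} [CommRing A] [Algebra F A] (i : ℤ) (p : F[X]) (α : A) :
    aeval α (shiftPow i p) = aeval (α + i) p := by
  simp [shiftPow, aeval_comp]

theorem irreducible_shiftPow {i : ℤ} {p : F[X]} (hp : Irreducible p) :
    Irreducible (shiftPow i p) :=
  (MulEquiv.irreducible_iff (taylorEquiv (i : F))).2 hp

theorem isUnit_shiftPow {i : ℤ} {p : F[X]} (hp : IsUnit p) : IsUnit (shiftPow i p) :=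
  hp.map (taylorAlgHom (i : F))

theorem exists_common_root {p q : F[X]} (h : ¬ IsCoprime p q) :
    ∃ α : AlgebraicClosure F, aeval α p = 0 ∧ aeval α q = 0 := by
  rw [isCoprime_iff_aeval_ne_zero_of_isAlgClosed F (AlgebraicClosure F)] at h
  push Not at h
  exact h

theorem not_isCoprime_of_common_root {p q : F[X]} {α : AlgebraicClosure F}
    (hp : aeval α p = 0) (hq : aeval α q = 0) : ¬ IsCoprime p q := by
  rw [isCoprime_iff_aeval_ne_zero_of_isAlgClosed F (AlgebraicClosure F)]
  push Not
  exact ⟨α, hp, hq⟩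

variable [CharZero F]

/-- A common root of `p` and `σ_y^j(q)` makes `j` a difference of a root of `q` and a root of `p`;
in characteristic zero only finitely many integers arise this way. -/
theorem exists_forall_isCoprime_shiftPow {p q : F[X]} (hp : p ≠ 0) (hq : q ≠ 0) :
    ∃ M : ℕ, ∀ j : ℤ, (M : ℤ) ≤ |j| → IsCoprime p (shiftPow j q) := by
  classical
  have : CharZero (AlgebraicClosure F) := charZero_of_injective_algebraMap
    (algebraMap F (AlgebraicClosure F)).injective
  set P := p.aroots (AlgebraicClosure F)
  set Q := q.aroots (AlgebraicClosure F)
  have hfin : {j : ℤ | ¬ IsCoprime p (shiftPow j q)}.Finite := by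
    refine Set.Finite.subset (s := (fun j : ℤ => (j : AlgebraicClosure F)) ⁻¹'
      ((Q.toFinset ×ˢ P.toFinset).image fun z => z.1 - z.2 : Finset _)) ?_ ?_
    · exact (Finset.finite_toSet _).preimage Int.cast_injective.injOn
    · intro j hj
      obtain ⟨α, h1, h2⟩ := exists_common_root hj
      rw [aeval_shiftPow] at h2
      simp only [Set.mem_preimage, Finset.coe_image, Set.mem_image, Finset.mem_coe,
        Finset.mem_product, Multiset.mem_toFinset, Prod.exists]
      exact ⟨α + j, α, ⟨(mem_aroots.2 ⟨hq, h2⟩), (mem_aroots.2 ⟨hp, h1⟩)⟩, by ring⟩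
  refine ⟨(∑ j ∈ hfin.toFinset, j.natAbs) + 1, fun j hj => ?_⟩
  by_contra hc
  have : j.natAbs ≤ ∑ j ∈ hfin.toFinset, j.natAbs := Finset.single_le_sum
    (f := fun j : ℤ => j.natAbs) (fun _ _ => Nat.zero_le _) (hfin.mem_toFinset.2 hc)
  rw [Int.abs_eq_natAbs] at hj
  omega

theorem isShiftFree_iff {p : F[X]} :
    IsShiftFree p ↔ p ≠ 0 ∧ ∀ n : ℤ, n ≠ 0 → IsCoprime p (shiftPow n p) := by
  have : CharZero (AlgebraicClosure F) := charZero_of_injective_algebraMap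
    (algebraMap F (AlgebraicClosure F)).injective
  refine and_congr_right fun _ => ⟨fun h n hn => ?_, fun h α β hα hβ n hn => ?_⟩
  · by_contra hc
    obtain ⟨α, h1, h2⟩ := exists_common_root hc
    rw [aeval_shiftPow] at h2
    have := h _ _ h2 h1 n (by ring)
    simp [hn] at this
  · by_contra hne
    have hn0 : n ≠ 0 := by
      rintro rfl
      exact hne (sub_eq_zero.1 (by simpa using hn))
    refine not_isCoprime_of_common_root hβ ?_ (h n hn0)
    rw [aeval_shiftPow, ← hn]
    simpa using hα

theorem isShiftFree_of_irreducible {p : F[X]} (hp : Irreducible p) :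
    ∀ n : ℤ, n ≠ 0 → IsCoprime p (shiftPow n p) := by
  intro n hn
  by_contra hc
  have hdvd : p ∣ shiftPow n p := by
    by_contra h
    exact hc (hp.coprime_iff_not_dvd.2 h)
  -- One nontrivial self-shift iterates to infinitely many, against the finiteness of non-coprime
  -- shifts.
  have hall : ∀ m : ℕ, p ∣ shiftPow (m * n) p := by
    intro m
    induction m with
    | zero => simp
    | succ m ih =>
      refine ih.trans ?_
      have := shiftPow_dvd_shiftPow (m * n) hdvd
      rw [shiftPow_shiftPow] at this
      convert this using 2
      push_cast
      ring
  obtain ⟨M, hM⟩ := exists_forall_isCoprime_shiftPow hp.ne_zero hp.ne_zero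
  refine hp.not_isUnit ((hM (M * n) ?_).isUnit_of_dvd' dvd_rfl (hall M))
  rw [abs_mul, Nat.abs_cast]
  exact le_mul_of_one_le_right (by positivity) (Int.one_le_abs hn)

end Shift

/-! ### Divisibility up to shifts -/

section ShiftProd

variable {F : Type*} [Field F]

/-- The product of the shifts `σ_y ^ j (p)` for `j` in a finite set of integers. -/
noncomputable def shiftProd (s : Finset ℤ) (p : F[X]) : F[X] := ∏ j ∈ s, shiftPow j p

/-- `d` divides a product of distinct shifts of `e`. -/
def ShiftDvd (d e : F[X]) : Prop := ∃ s : Finset ℤ, d ∣ shiftProd s e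

/-- Every product of distinct shifts of `d` divides a product of distinct shifts of `e`. -/
def ShiftProdDvd (d e : F[X]) : Prop := ∀ s : Finset ℤ, ShiftDvd (shiftProd s d) e

theorem shiftProd_mul (s : Finset ℤ) (p q : F[X]) :
    shiftProd s (p * q) = shiftProd s p * shiftProd s q := by
  simp [shiftProd, Finset.prod_mul_distrib]

theorem shiftProd_dvd_of_subset {s t : Finset ℤ} (h : s ⊆ t) (p : F[X]) :
    shiftProd s p ∣ shiftProd t p := Finset.prod_dvd_prod_of_subset _ _ _ h

theorem ShiftDvd.mul {d₁ d₂ e₁ e₂ : F[X]} (h₁ : ShiftDvd d₁ e₁) (h₂ : ShiftDvd d₂ e₂) :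
    ShiftDvd (d₁ * d₂) (e₁ * e₂) := by
  obtain ⟨s, hs⟩ := h₁
  obtain ⟨t, ht⟩ := h₂
  refine ⟨s ∪ t, ?_⟩
  rw [shiftProd_mul]
  exact mul_dvd_mul (hs.trans (shiftProd_dvd_of_subset Finset.subset_union_left _))
    (ht.trans (shiftProd_dvd_of_subset Finset.subset_union_right _))

/-- `ShiftDvd` alone does not compose: shifts of a product of shifts may repeat, raising
multiplicities. `ShiftProdDvd` on the right is what keeps the shifts distinct. -/
theorem ShiftDvd.trans {d e f : F[X]} (h₁ : ShiftDvd d e) (h₂ : ShiftProdDvd e f) :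
    ShiftDvd d f := by
  obtain ⟨s, hs⟩ := h₁
  obtain ⟨t, ht⟩ := h₂ s
  exact ⟨t, hs.trans ht⟩

theorem ShiftDvd.of_dvd {d e f : F[X]} (h : d ∣ e) (h' : ShiftDvd e f) : ShiftDvd d f := by
  obtain ⟨s, hs⟩ := h'
  exact ⟨s, h.trans hs⟩

theorem ShiftDvd.of_isUnit {d : F[X]} (h : IsUnit d) (e : F[X]) : ShiftDvd d e :=
  ⟨∅, h.dvd⟩

theorem ShiftDvd.of_dvd_shiftPow {d e : F[X]} (i : ℤ) (h : d ∣ shiftPow i e) : ShiftDvd d e :=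
  ⟨{i}, by simpa [shiftProd] using h⟩

theorem ShiftProdDvd.mul {d₁ d₂ e₁ e₂ : F[X]} (h₁ : ShiftProdDvd d₁ e₁)
    (h₂ : ShiftProdDvd d₂ e₂) : ShiftProdDvd (d₁ * d₂) (e₁ * e₂) := fun s => by
  rw [shiftProd_mul]
  exact (h₁ s).mul (h₂ s)

theorem ShiftProdDvd.shiftDvd {d e : F[X]} (h : ShiftProdDvd d e) : ShiftDvd d e := by
  simpa [shiftProd] using h {0}

theorem ShiftProdDvd.refl (d : F[X]) : ShiftProdDvd d d := fun s => ⟨s, dvd_rfl⟩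

theorem ShiftProdDvd.of_isUnit {d : F[X]} (h : IsUnit d) (e : F[X]) : ShiftProdDvd d e :=
  fun _ => .of_isUnit ((Finset.prod_induction _ IsUnit (fun _ _ => IsUnit.mul) isUnit_one
    fun _ _ => isUnit_shiftPow h)) e

theorem shiftProdDvd_shiftPow (n : ℤ) (p : F[X]) : ShiftProdDvd p (shiftPow n p) := fun s => by
  refine ⟨s.map (Equiv.subRight n).toEmbedding, ?_⟩
  simp [shiftProd, Finset.prod_map]

end ShiftProd

/-! ### Covering the shift classes of a polynomial -/

section Cover

variable {F : Type*} [Field F]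

theorem IsStronglyPrime.mul {u v p q : F[X]} (hp : IsStronglyPrime u v p)
    (hq : IsStronglyPrime u v q) : IsStronglyPrime u v (p * q) :=
  ⟨mul_ne_zero hp.1 hq.1, fun i => ⟨(hp.2 i).1.mul_left (hq.2 i).1, (hp.2 i).2.mul_left (hq.2 i).2⟩⟩

theorem IsStronglyPrime.of_dvd {u v p q : F[X]} (hp : IsStronglyPrime u v p) (h : q ∣ p) :
    IsStronglyPrime u v q :=
  ⟨ne_zero_of_dvd_ne_zero hp.1 h, fun i =>
    ⟨(hp.2 i).1.of_isCoprime_of_dvd_left h, (hp.2 i).2.of_isCoprime_of_dvd_left h⟩⟩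

variable [CharZero F]

/-- The shift class of `p` cannot meet both `u` and `v`, as `K` is shift-reduced. If it misses `v`,
shifting far forward avoids all `σ_y^{-i}(u)`; if it meets `v`, it misses `u`, and shifting far
backward avoids all `σ_y^i(v)`. -/
theorem exists_isStronglyPrime_shiftPow {u v p : F[X]} (hu : u ≠ 0) (hv : v ≠ 0)
    (huv : ∀ i : ℤ, IsCoprime u (shiftPow i v)) (hp : Irreducible p) :
    ∃ n : ℤ, IsStronglyPrime u v (shiftPow n p) := by
  by_cases h : ∀ j : ℤ, IsCoprime (shiftPow j p) v
  · obtain ⟨M, hM⟩ := exists_forall_isCoprime_shiftPow hp.ne_zero hu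
    refine ⟨M, shiftPow_ne_zero hp.ne_zero, fun i => ⟨?_, ?_⟩⟩
    · rw [isCoprime_shiftPow_iff]
      exact hM _ (by rw [abs_of_nonpos] <;> omega)
    · rw [isCoprime_shiftPow_iff]
      have := h (-(i - M))
      rw [← shiftPow_zero v, isCoprime_shiftPow_iff] at this
      simpa using this
  · push Not at h
    obtain ⟨j, hj⟩ := h
    have hd : shiftPow j p ∣ v := by
      by_contra hd
      exact hj ((irreducible_shiftPow hp).coprime_iff_not_dvd.2 hd)
    obtain ⟨M, hM⟩ := exists_forall_isCoprime_shiftPow hp.ne_zero hv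
    refine ⟨-M, shiftPow_ne_zero hp.ne_zero, fun i => ⟨?_, ?_⟩⟩
    · have h1 := (huv (-(M : ℤ) - j + i)).symm.of_isCoprime_of_dvd_left
        (shiftPow_dvd_shiftPow (-(M : ℤ) - j + i) hd)
      rw [← shiftPow_zero u, shiftPow_shiftPow, isCoprime_shiftPow_iff] at h1
      rw [isCoprime_shiftPow_iff]
      convert h1 using 2
      ring
    · rw [isCoprime_shiftPow_iff]
      exact hM _ (by rw [abs_of_nonneg] <;> omega)

theorem exists_shiftFree_stronglyPrime_cover {u v b : F[X]} (hu : u ≠ 0) (hv : v ≠ 0)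
    (huv : ∀ i : ℤ, IsCoprime u (shiftPow i v)) (hb : IsShiftFree b)
    (hb' : IsStronglyPrime u v b) {d : F[X]} (hd : d ≠ 0) :
    ∃ B : F[X], IsShiftFree B ∧ IsStronglyPrime u v B ∧ b ∣ B ∧ ShiftProdDvd d B := by
  induction d using WfDvdMonoid.induction_on_irreducible with
  | zero => exact absurd rfl hd
  | unit d h => exact ⟨b, hb, hb', dvd_rfl, .of_isUnit h b⟩
  | mul d p hd0 hp ih =>
    obtain ⟨B, h1, h2, h3, h4⟩ := ih hd0
    rw [isShiftFree_iff] at h1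
    obtain ⟨n, hn, hfree⟩ : ∃ n : ℤ, IsStronglyPrime u v (shiftPow n p) ∧
        ∀ m : ℤ, m ≠ 0 → IsCoprime B (shiftPow (m + n) p) := by
      -- A class already represented in `B` must reuse the same shift, so that only its multiplicity
      -- grows and shift-freeness survives.
      by_cases h : ∃ n : ℤ, ¬ IsCoprime (shiftPow n p) B
      · obtain ⟨n, hn⟩ := h
        have hdvd : shiftPow n p ∣ B := by
          by_contra h
          exact hn ((irreducible_shiftPow hp).coprime_iff_not_dvd.2 h)
        refine ⟨n, h2.of_dvd hdvd, fun m hm => ?_⟩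
        refine (h1.2 m hm).of_isCoprime_of_dvd_right ?_
        simpa using shiftPow_dvd_shiftPow m hdvd
      · push Not at h
        obtain ⟨n, hn⟩ := exists_isStronglyPrime_shiftPow hu hv huv hp
        exact ⟨n, hn, fun m _ => (h _).symm⟩
    refine ⟨shiftPow n p * B, ?_, hn.mul h2, h3.mul_left _, (shiftProdDvd_shiftPow n p).mul h4⟩
    rw [isShiftFree_iff]
    refine ⟨mul_ne_zero hn.1 h1.1, fun m hm => ?_⟩
    rw [shiftPow_mul, shiftPow_shiftPow]
    refine IsCoprime.mul_left (IsCoprime.mul_right ?_ ?_)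
      (IsCoprime.mul_right (hfree m hm) (h1.2 m hm))
    · rw [isCoprime_shiftPow_iff]
      simpa using isShiftFree_of_irreducible hp m hm
    · have := (hfree (-m) (neg_ne_zero.2 hm)).symm
      rw [← isCoprime_shiftPow_shiftPow (i := m), shiftPow_shiftPow] at this
      simpa using this

end Cover


/-! ### Reduction of rational functions modulo `Δ_K` -/

section Reduction

variable {F : Type*} [Field F]

theorem shiftVar_div (p q : F[X]) :
    shiftVar F (algebraMap F[X] (RatFunc F) p / algebraMap F[X] (RatFunc F) q) =
      algebraMap F[X] (RatFunc F) (shiftPow 1 p) / algebraMap F[X] (RatFunc F) (shiftPow 1 q) := by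
  rw [shiftVar, RatFunc.coe_mapRingHom_eq_coe_map, RatFunc.map_apply_div]
  simp [shiftPow_eq_taylor]

theorem shiftVar_algebraMap (p : F[X]) :
    shiftVar F (algebraMap F[X] (RatFunc F) p) = algebraMap F[X] (RatFunc F) (shiftPow 1 p) := by
  simpa using shiftVar_div p 1

/-- The rational function `f` is of the form `K σ_y(g) - g + s / B + t / v`, where `K = u / v`,
with `g` a rational function and `s`, `t` polynomials. -/
def IsReducible (u v B : F[X]) (f : RatFunc F) : Prop :=
  ∃ (g : RatFunc F) (s t : F[X]),
    f = algebraMap F[X] (RatFunc F) u / algebraMap F[X] (RatFunc F) v * shiftVar F g - g +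
      remainder v B s t

/-- All rational functions with denominator `d` are reducible. -/
def IsReducibleDenom (u v B d : F[X]) : Prop :=
  ∀ c : F[X], IsReducible u v B (algebraMap F[X] (RatFunc F) c / algebraMap F[X] (RatFunc F) d)

variable {u v B d e : F[X]}

theorem IsReducible.add {f g : RatFunc F} (hf : IsReducible u v B f) (hg : IsReducible u v B g) :
    IsReducible u v B (f + g) := by
  obtain ⟨f', s, t, rfl⟩ := hf
  obtain ⟨g', s', t', rfl⟩ := hg
  refine ⟨f' + g', s + s', t + t', ?_⟩
  simp only [remainder, map_add]
  ring

/-- `g` and `K σ_y(g)` differ by `K σ_y(g) - g`, which is absorbed into the summable part. -/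
theorem IsReducible.shift {g : RatFunc F}
    (hg : IsReducible u v B
      (algebraMap F[X] (RatFunc F) u / algebraMap F[X] (RatFunc F) v * shiftVar F g)) :
    IsReducible u v B g := by
  obtain ⟨f', s, t, h⟩ := hg
  refine ⟨f' - g, s, t, ?_⟩
  rw [map_sub]
  linear_combination h

theorem IsReducible.of_shift {g : RatFunc F} (hg : IsReducible u v B g) :
    IsReducible u v B
      (algebraMap F[X] (RatFunc F) u / algebraMap F[X] (RatFunc F) v * shiftVar F g) := by
  obtain ⟨f', s, t, h⟩ := hg
  refine ⟨f' + g, s, t, ?_⟩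
  rw [map_add]
  linear_combination h

theorem algebraMap_ratFunc_ne_zero (hd : d ≠ 0) : algebraMap F[X] (RatFunc F) d ≠ 0 :=
  RatFunc.algebraMap_ne_zero hd

theorem IsReducibleDenom.mul (hd0 : d ≠ 0) (he0 : e ≠ 0) (hd : IsReducibleDenom u v B d)
    (he : IsReducibleDenom u v B e) (h : IsCoprime d e) : IsReducibleDenom u v B (d * e) := by
  intro c
  obtain ⟨r, s, hrs⟩ := h
  have hd0 := algebraMap_ratFunc_ne_zero hd0
  have he0 := algebraMap_ratFunc_ne_zero he0
  convert (hd (c * s)).add (he (c * r)) using 1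
  have := congrArg (algebraMap F[X] (RatFunc F)) hrs
  simp only [map_add, map_mul, map_one] at this ⊢
  field_simp
  linear_combination -(algebraMap F[X] (RatFunc F) c) * this

theorem IsReducibleDenom.of_dvd (hd0 : d ≠ 0) (hd : IsReducibleDenom u v B d) (h : e ∣ d) :
    IsReducibleDenom u v B e := by
  intro c
  obtain ⟨r, rfl⟩ := h
  have h1 := algebraMap_ratFunc_ne_zero (left_ne_zero_of_mul hd0)
  have h2 := algebraMap_ratFunc_ne_zero (right_ne_zero_of_mul hd0)
  convert hd (c * r) using 1
  simp only [map_mul]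
  field_simp

theorem isReducibleDenom_self (u v B : F[X]) : IsReducibleDenom u v B B :=
  fun c => ⟨0, c, 0, by simp [remainder]⟩

theorem isReducibleDenom_right (u v B : F[X]) : IsReducibleDenom u v B v :=
  fun c => ⟨0, 0, c, by simp [remainder]⟩

/-- `K σ_y(c/d)` has denominator `v σ_y(d)`, which partial fractions split. -/
theorem IsReducibleDenom.of_shift_forward (hv : v ≠ 0) (hd0 : d ≠ 0)
    (hd : IsReducibleDenom u v B (shiftPow 1 d)) (h : IsCoprime (shiftPow 1 d) v) :
    IsReducibleDenom u v B d := by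
  intro c
  apply IsReducible.shift
  convert hd.mul (shiftPow_ne_zero hd0) hv (isReducibleDenom_right u v B) h
    (u * shiftPow 1 c) using 1
  rw [shiftVar_div, map_mul, map_mul, div_mul_div_comm, mul_comm (algebraMap F[X] (RatFunc F) v)]

theorem IsReducibleDenom.of_shift_backward (hu : u ≠ 0) (hv : v ≠ 0) (hd0 : d ≠ 0)
    (hd : IsReducibleDenom u v B (shiftPow (-1) d)) (h : IsCoprime d u) :
    IsReducibleDenom u v B d := by
  -- Applying `K σ_y` cancels `u` and leaves denominator `v`.
  have hu' : IsReducibleDenom u v B (shiftPow (-1) u) := by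
    intro c
    apply IsReducible.shift
    convert isReducibleDenom_right u v B (shiftPow 1 c) using 1
    have := algebraMap_ratFunc_ne_zero hu
    have := algebraMap_ratFunc_ne_zero hv
    rw [shiftVar_div]
    simp only [shiftPow_shiftPow, add_neg_cancel, shiftPow_zero]
    field_simp
  intro c
  -- `c/d = K σ_y(w)` for `w = σ_y⁻¹(c v) / (σ_y⁻¹(d) σ_y⁻¹(u))`.
  have := (hd.mul (shiftPow_ne_zero hd0) (shiftPow_ne_zero hu) hu'
    (isCoprime_shiftPow_shiftPow.2 h) (shiftPow (-1) (c * v))).of_shift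
  convert this using 1
  have := algebraMap_ratFunc_ne_zero hu
  have := algebraMap_ratFunc_ne_zero hv
  have := algebraMap_ratFunc_ne_zero hd0
  rw [shiftVar_div]
  simp only [shiftPow_mul, shiftPow_shiftPow, add_neg_cancel, shiftPow_zero, map_mul]
  field_simp

/-- Positive shifts step backward, needing coprimality with `u`; negative ones step forward, needing
coprimality with `v`. These are exactly the two halves of strong primeness. -/
theorem IsStronglyPrime.isReducibleDenom_shiftPow (hu : u ≠ 0) (hv : v ≠ 0)
    (hB : IsStronglyPrime u v B) (n : ℤ) : IsReducibleDenom u v B (shiftPow n B) := by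
  induction n using Int.induction_on with
  | zero => simpa using isReducibleDenom_self u v B
  | succ n ih =>
    refine .of_shift_backward hu hv (shiftPow_ne_zero hB.1) ?_ ?_
    · simpa using ih
    · have := (hB.2 (n + 1)).1
      rw [← shiftPow_zero u, isCoprime_shiftPow_iff]
      simpa using this
  | pred n ih =>
    refine .of_shift_forward hv (shiftPow_ne_zero hB.1) ?_ ?_
    · simpa using ih
    · have := (hB.2 n).2
      rw [shiftPow_shiftPow, ← shiftPow_zero v, isCoprime_shiftPow_iff]
      simpa using this

theorem shiftProd_ne_zero (s : Finset ℤ) (hB : B ≠ 0) : shiftProd s B ≠ 0 :=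
  Finset.prod_ne_zero_iff.2 fun _ _ => shiftPow_ne_zero hB

theorem IsStronglyPrime.isReducibleDenom_of_shiftDvd [CharZero F] (hu : u ≠ 0) (hv : v ≠ 0)
    (hB : IsStronglyPrime u v B) (hfree : IsShiftFree B) (h : ShiftDvd d B) :
    IsReducibleDenom u v B d := by
  obtain ⟨s, hs⟩ := h
  refine IsReducibleDenom.of_dvd (shiftProd_ne_zero s hB.1) ?_ hs
  clear hs
  induction s using Finset.induction_on with
  | empty => exact (isReducibleDenom_self u v B).of_dvd hB.1 (by simp [shiftProd])
  | insert n s hn ih =>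
    rw [shiftProd, Finset.prod_insert hn]
    refine (hB.isReducibleDenom_shiftPow hu hv n).mul (shiftPow_ne_zero hB.1)
      (shiftProd_ne_zero s hB.1) ih (IsCoprime.prod_right fun m hm => ?_)
    rw [isCoprime_shiftPow_iff]
    exact (isShiftFree_iff.1 hfree).2 _ (sub_ne_zero.2 (ne_of_mem_of_not_mem hm hn))

end Reduction

/-! ### The standard complement -/

section StandardComplement

variable {F : Type*} [Field F]

theorem phi_add (u v p q : F[X]) : phi u v (p + q) = phi u v p + phi u v q := by
  simp only [phi, shiftPow_add_right]
  ring

theorem phi_C_mul (u v p : F[X]) (c : F) : phi u v (C c * p) = C c * phi u v p := by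
  simp only [phi, shiftPow_mul, shiftPow_C]
  ring

/-- The leading term is removed by a multiple of some `phi u v p` if its degree is attained there,
and otherwise by a monomial of the complement. -/
theorem exists_phi_add_mem_standardComplement (u v t : F[X]) :
    ∃ p, ∃ q ∈ standardComplement u v, t = phi u v p + q := by
  suffices H : ∀ n : ℕ, ∀ t : F[X], t.degree < n →
      ∃ p, ∃ q ∈ standardComplement u v, t = phi u v p + q from
    H (t.natDegree + 1) t (degree_le_natDegree.trans_lt (by exact_mod_cast Nat.lt_succ_self _))
  intro n
  induction n with
  | zero =>
    intro t ht
    have : t = 0 := by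
      ext m
      exact (degree_lt_iff_coeff_zero _ _).1 ht m (Nat.zero_le m)
    exact ⟨0, 0, zero_mem _, by simp [this, phi, shiftPow]⟩
  | succ n ih =>
    intro t ht
    obtain ⟨p, q, hq, hlt⟩ : ∃ p, ∃ q ∈ standardComplement u v,
        (t - (phi u v p + q)).degree < n := by
      have hcoeff : ∀ r : F[X], r.degree ≤ n → r.coeff n = t.coeff n → (t - r).degree < n := by
        intro r hr hrt
        rw [degree_lt_iff_coeff_zero]
        intro m hm
        rw [coeff_sub]
        rcases hm.eq_or_lt with rfl | hm
        · rw [hrt, sub_self]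
        · rw [coeff_eq_zero_of_degree_lt (ht.trans_le (by exact_mod_cast hm)),
            coeff_eq_zero_of_degree_lt (hr.trans_lt (by exact_mod_cast hm)), sub_zero]
      by_cases h : ∃ p : F[X], (phi u v p).degree = n
      · obtain ⟨p, hp⟩ := h
        have hne : (phi u v p).coeff n ≠ 0 := coeff_ne_zero_of_eq_degree hp
        refine ⟨C (t.coeff n / (phi u v p).coeff n) * p, 0, zero_mem _, ?_⟩
        rw [add_zero, phi_C_mul, ← smul_eq_C_mul]
        refine hcoeff _ ((degree_smul_le _ _).trans hp.le) ?_
        rw [coeff_smul, smul_eq_mul, div_mul_cancel₀ _ hne]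
      · push Not at h
        refine ⟨0, t.coeff n • X ^ n,
          Submodule.smul_mem _ _ (Submodule.subset_span ⟨n, rfl, h⟩), ?_⟩
        rw [show phi u v 0 = 0 by simp [phi, shiftPow], zero_add]
        refine hcoeff _ ?_ (by simp)
        rw [smul_eq_C_mul]
        exact degree_C_mul_X_pow_le _ _
    obtain ⟨p', q', hq', h⟩ := ih _ hlt
    exact ⟨p + p', q + q', add_mem hq hq', by rw [phi_add]; linear_combination h⟩

theorem coeff_mul_X_add_C_pow (p : F[X]) (m n : ℕ) (r : F) (hp : p.natDegree ≤ m + 1) :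
    (p * (X + C r) ^ n).coeff (m + 1 + n) = p.coeff (m + 1) ∧
      (p * (X + C r) ^ n).coeff (m + n) = p.coeff m + n * r * p.coeff (m + 1) := by
  induction n generalizing p m with
  | zero => simp
  | succ n ih =>
    have hp' : (p * (X + C r)).natDegree ≤ m + 1 + 1 :=
      natDegree_mul_le.trans (add_le_add hp (natDegree_X_add_C r).le)
    have h1 : (p * (X + C r)).coeff (m + 1 + 1) = p.coeff (m + 1) := by
      rw [mul_add, coeff_add, coeff_mul_X, coeff_mul_C,
        coeff_eq_zero_of_natDegree_lt (n := m + 1 + 1) (by omega), zero_mul, add_zero]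
    have h2 : (p * (X + C r)).coeff (m + 1) = p.coeff m + p.coeff (m + 1) * r := by
      rw [mul_add, coeff_add, coeff_mul_X, coeff_mul_C]
    obtain ⟨h3, h4⟩ := ih _ (m + 1) hp'
    rw [pow_succ', ← mul_assoc, show m + 1 + (n + 1) = m + 1 + 1 + n by ring,
      show m + (n + 1) = m + 1 + n by ring, h3, h4, h1, h2]
    refine ⟨rfl, ?_⟩
    push_cast
    ring

/-- Let `m = max (deg u) (deg v)`. The coefficient of `y^(m+n)` in `φ_K(y^n)` does not depend on
`n`. If it vanishes, the next one is affine in `n` with nonzero slope, so it vanishes for at most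
one `n`. Multiplying by `X` avoids the index `m - 1` when `m = 0`. -/
theorem exists_degree_phi_eq [CharZero F] {u v : F[X]} (hu : u ≠ 0) :
    ∃ N : ℕ, ∀ l : ℕ, N ≤ l → ∃ p : F[X], (phi u v p).degree = l := by
  obtain ⟨m, hm⟩ : ∃ m, m + 1 = max (X * u).natDegree (X * v).natDegree := by
    refine ⟨_, Nat.sub_add_cancel (le_max_of_le_left ?_)⟩
    rw [natDegree_X_mul hu]
    omega
  have hU : (X * u).natDegree ≤ m + 1 := hm ▸ le_max_left _ _
  have hV : (X * v).natDegree ≤ m + 1 := hm ▸ le_max_right _ _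
  have hphi (n : ℕ) :
      X * phi u v (X ^ n) = X * u * (X + C 1) ^ n - X * v * (X + C 0) ^ n := by
    simp only [phi, shiftPow, X_pow_comp, Int.cast_one, C_0, add_zero]
    ring
  have htop (n : ℕ) : (X * phi u v (X ^ n)).coeff (m + 1 + n) =
      (X * u).coeff (m + 1) - (X * v).coeff (m + 1) := by
    rw [hphi, coeff_sub, (coeff_mul_X_add_C_pow _ m n _ hU).1,
      (coeff_mul_X_add_C_pow _ m n _ hV).1]
  have hnext (n : ℕ) : (X * phi u v (X ^ n)).coeff (m + n) =
      (X * u).coeff m - (X * v).coeff m + (n : F) * (X * u).coeff (m + 1) := by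
    rw [hphi, coeff_sub, (coeff_mul_X_add_C_pow _ m n _ hU).2,
      (coeff_mul_X_add_C_pow _ m n _ hV).2]
    ring
  have hle (n : ℕ) : (X * phi u v (X ^ n)).natDegree ≤ m + 1 + n := by
    have (r : F) : ((X + C r) ^ n).natDegree ≤ n := by
      simp
    rw [hphi]
    exact (natDegree_sub_le_of_le (natDegree_mul_le.trans (add_le_add hU (this 1)))
      (natDegree_mul_le.trans (add_le_add hV (this 0)))).trans (max_self _).le
  have hdeg (p : F[X]) (j : ℕ) (h : (X * p).natDegree ≤ j + 1) (h' : (X * p).coeff (j + 1) ≠ 0) :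
      p.degree = j := by
    rw [coeff_X_mul] at h'
    have hp : p ≠ 0 := by
      rintro rfl
      simp at h'
    rw [natDegree_X_mul hp] at h
    exact degree_eq_of_le_of_coeff_ne_zero
      (degree_le_natDegree.trans (by exact_mod_cast Nat.le_of_succ_le_succ h)) h'
  by_cases h : (X * u).coeff (m + 1) = (X * v).coeff (m + 1)
  · have hne : (X * u).coeff (m + 1) ≠ 0 := by
      intro h0
      rcases le_total (X * u).natDegree (X * v).natDegree with hc | hc
      · rw [max_eq_right hc] at hm
        rw [h, hm, coeff_natDegree, leadingCoeff_eq_zero] at h0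
        simp [h0] at hm
      · rw [max_eq_left hc] at hm
        rw [hm, coeff_natDegree, leadingCoeff_eq_zero] at h0
        simp [h0] at hm
    have hbound : ∃ n₀ : ℕ, ∀ n : ℕ, n₀ ≤ n → (X * phi u v (X ^ n)).coeff (m + n) ≠ 0 := by
      by_cases hex : ∃ n₀ : ℕ, (X * phi u v (X ^ n₀)).coeff (m + n₀) = 0
      · obtain ⟨n₀, h0⟩ := hex
        refine ⟨n₀ + 1, fun n hn hn' => ?_⟩
        rw [hnext] at h0 hn'
        have : ((n : F) - n₀) * (X * u).coeff (m + 1) = 0 := by linear_combination hn' - h0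
        rcases mul_eq_zero.1 this with h | h
        · have : n = n₀ := by exact_mod_cast sub_eq_zero.1 h
          omega
        · exact hne h
      · push Not at hex
        exact ⟨0, fun n _ => hex n⟩
    obtain ⟨n₀, hn₀⟩ := hbound
    -- Here `φ_K(y^n)` has degree `m + n - 1`, hence `n = l + 1 - m`.
    refine ⟨m + n₀, fun l hl => ⟨X ^ (l + 1 - m), hdeg _ _ ?_ ?_⟩⟩
    · have h1 := hle (l + 1 - m)
      rw [show m + 1 + (l + 1 - m) = l + 1 + 1 by omega] at h1
      refine Nat.le_of_lt_succ (lt_of_le_of_ne h1 fun he => ?_)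
      have h2 := htop (l + 1 - m)
      rw [h, sub_self, show m + 1 + (l + 1 - m) = l + 1 + 1 by omega,
        ← Nat.succ_eq_add_one (l + 1), ← he, coeff_natDegree, leadingCoeff_eq_zero] at h2
      simp [h2] at he
    · have := hn₀ (l + 1 - m) (by omega)
      rwa [show m + (l + 1 - m) = l + 1 by omega] at this
  · refine ⟨m, fun l hl => ⟨X ^ (l - m), hdeg _ _ ?_ ?_⟩⟩
    · have := hle (l - m)
      omega
    · have := htop (l - m)
      rw [show m + 1 + (l - m) = l + 1 by omega] at this
      rw [this]
      exact sub_ne_zero.2 h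

theorem exists_standardComplement_le_degreeLT [CharZero F] {u v : F[X]} (hu : u ≠ 0) :
    ∃ N : ℕ, standardComplement u v ≤ degreeLT F N := by
  obtain ⟨N, hN⟩ := exists_degree_phi_eq (v := v) hu
  refine ⟨N, Submodule.span_le.2 ?_⟩
  rintro _ ⟨l, rfl, hl⟩
  rw [SetLike.mem_coe, mem_degreeLT, degree_X_pow]
  by_contra h
  obtain ⟨p, hp⟩ := hN l (by exact_mod_cast not_lt.1 h)
  exact hl p hp

theorem finiteDimensional_span_remainder [CharZero F] {u v B : F[X]} (hu : u ≠ 0)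
    {ι : Type*} (a q : ι → F[X]) (ha : ∀ i, (a i).degree < B.degree)
    (hq : ∀ i, q i ∈ standardComplement u v) :
    FiniteDimensional F (Submodule.span F (Set.range fun i => remainder v B (a i) (q i))) := by
  obtain ⟨N, hN⟩ := exists_standardComplement_le_degreeLT (v := v) hu
  let f (d : F[X]) : F[X] →ₗ[F] RatFunc F :=
    LinearMap.mulRight F (algebraMap F[X] (RatFunc F) d)⁻¹ ∘ₗ
      (IsScalarTower.toAlgHom F F[X] (RatFunc F)).toLinearMap
  have hfin (n : ℕ) : FiniteDimensional F (degreeLT F n) :=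
    Module.Finite.equiv (degreeLTEquiv F n).symm
  refine Submodule.finiteDimensional_of_le
    (S₂ := (degreeLT F (B.natDegree + 1)).map (f B) ⊔ (degreeLT F N).map (f v))
    (Submodule.span_le.2 ?_)
  rintro _ ⟨i, rfl⟩
  have ha' : a i ∈ degreeLT F (B.natDegree + 1) := by
    rw [mem_degreeLT]
    refine (ha i).trans_le (degree_le_natDegree.trans ?_)
    exact_mod_cast Nat.le_succ _
  have hmem := Submodule.add_mem_sup (Submodule.mem_map_of_mem (f := f B) ha')
    (Submodule.mem_map_of_mem (f := f v) (hN (hq i)))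
  rwa [show f B (a i) + f v (q i) = remainder v B (a i) (q i) by
    simp [f, remainder, div_eq_mul_inv]] at hmem

end StandardComplement


/-! ### Shift-equivalent rational functions -/

section Transfer

variable {F : Type*} [Field F]

/-- The hypothesis says `r/s = σ_y(w)/w` with `w = n₁/n₂`, so products of consecutive shifts of
`r/s` telescope. -/
theorem shiftProd_range_telescope {r s n₁ n₂ : F[X]} (h₁ : n₁ ≠ 0) (h₂ : n₂ ≠ 0)
    (h : r * n₁ * shiftPow 1 n₂ = s * shiftPow 1 n₁ * n₂) (L : ℕ) :
    (∏ j ∈ Finset.range L, shiftPow (j : ℤ) r) * n₁ * shiftPow L n₂ =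
      (∏ j ∈ Finset.range L, shiftPow (j : ℤ) s) * shiftPow L n₁ * n₂ := by
  induction L with
  | zero => simp
  | succ L ih =>
    have hL := congrArg (shiftPow (L : ℤ)) h
    simp only [shiftPow_mul, shiftPow_shiftPow] at hL
    have e1 : shiftPow (L : ℤ) n₁ ≠ 0 := shiftPow_ne_zero h₁
    have e2 : shiftPow (L : ℤ) n₂ ≠ 0 := shiftPow_ne_zero h₂
    refine mul_right_cancel₀ (mul_ne_zero e1 e2) ?_
    rw [Finset.prod_range_succ, Finset.prod_range_succ]
    push_cast
    linear_combination (shiftPow (L : ℤ) r * shiftPow (L : ℤ) n₁ * shiftPow (L + 1 : ℤ) n₂) * ih +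
      ((∏ j ∈ Finset.range L, shiftPow (j : ℤ) s) * shiftPow (L : ℤ) n₁ * n₂) * hL

theorem shiftProd_Ico_telescope {r s n₁ n₂ : F[X]} (h₁ : n₁ ≠ 0) (h₂ : n₂ ≠ 0)
    (h : r * n₁ * shiftPow 1 n₂ = s * shiftPow 1 n₁ * n₂) {M N : ℤ} (hMN : M ≤ N) :
    shiftProd (Finset.Ico M N) r * shiftPow M n₁ * shiftPow N n₂ =
      shiftProd (Finset.Ico M N) s * shiftPow N n₁ * shiftPow M n₂ := by
  obtain ⟨L, rfl⟩ := Int.le.dest hMN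
  have key (p : F[X]) : shiftProd (Finset.Ico M (M + L)) p =
      shiftPow M (∏ j ∈ Finset.range L, shiftPow (j : ℤ) p) := by
    rw [shiftPow_prod, shiftProd, Int.Ico_eq_finset_map, Finset.prod_map]
    simp
  have := congrArg (shiftPow M) (shiftProd_range_telescope h₁ h₂ h L)
  simpa only [key, shiftPow_mul, shiftPow_shiftPow] using this

variable [CharZero F]

theorem shiftDvd_denom_of_shift_eq {r s n₁ n₂ : F[X]} (h₁ : n₁ ≠ 0) (h₂ : n₂ ≠ 0)
    (h : r * n₁ * shiftPow 1 n₂ = s * shiftPow 1 n₁ * n₂) (hn : IsCoprime n₁ n₂) :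
    ShiftDvd n₂ r := by
  -- With `M` this large, the far boundary factor `σ_y^M(n₂)` is coprime to `n₂`.
  obtain ⟨M, hM⟩ := exists_forall_isCoprime_shiftPow h₂ h₂
  have := shiftProd_Ico_telescope h₁ h₂ h (Int.natCast_nonneg M)
  rw [shiftPow_zero, shiftPow_zero] at this
  refine ⟨Finset.Ico 0 (M : ℤ), ?_⟩
  refine hn.symm.dvd_of_dvd_mul_right ((hM M (le_abs_self _)).dvd_of_dvd_mul_right ?_)
  rw [this]
  exact dvd_mul_left _ _

/-- Telescoping over an interval containing `s` and reaching far beyond it on both sides makes the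
boundary factors coprime to the shifts of `v'`. Those of `u'` are coprime to them too, so only
shifts of `v` remain. -/
theorem shiftProdDvd_of_shift_eq {u v u' v' n₁ n₂ : F[X]} (hv' : v' ≠ 0)
    (huv' : ∀ i : ℤ, IsCoprime u' (shiftPow i v')) (h₁ : n₁ ≠ 0) (h₂ : n₂ ≠ 0)
    (h : u' * v * n₁ * shiftPow 1 n₂ = u * v' * shiftPow 1 n₁ * n₂) :
    ShiftProdDvd v' v := by
  intro s
  have hs := shiftProd_ne_zero s hv'
  obtain ⟨M₁, hM₁⟩ := exists_forall_isCoprime_shiftPow hs h₁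
  obtain ⟨M₂, hM₂⟩ := exists_forall_isCoprime_shiftPow hs h₂
  obtain ⟨M, hM, hM', hsub⟩ : ∃ M : ℕ, M₁ ≤ M ∧ M₂ ≤ M ∧ s ⊆ Finset.Ico (-(M : ℤ)) M := by
    refine ⟨M₁ + M₂ + (∑ j ∈ s, j.natAbs) + 1, by omega, by omega, fun j hj => ?_⟩
    have : j.natAbs ≤ ∑ j ∈ s, j.natAbs := Finset.single_le_sum
      (f := fun j : ℤ => j.natAbs) (fun _ _ => Nat.zero_le _) hj
    rw [Finset.mem_Ico]
    omega
  have heq := shiftProd_Ico_telescope h₁ h₂ h (show -(M : ℤ) ≤ M by omega)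
  refine ⟨Finset.Ico (-(M : ℤ)) M, ?_⟩
  have hu' : IsCoprime (shiftProd s v') (shiftProd (Finset.Ico (-(M : ℤ)) M) u') := by
    refine IsCoprime.prod_left fun i _ => IsCoprime.prod_right fun j _ => ?_
    exact (isCoprime_shiftPow_iff.2 (huv' _)).symm
  refine hu'.dvd_of_dvd_mul_left ?_
  rw [← shiftProd_mul]
  refine (hM₁ (-M) (by rw [abs_neg, Nat.abs_cast]; omega)).dvd_of_dvd_mul_right
    ((hM₂ M (by rw [Nat.abs_cast]; omega)).dvd_of_dvd_mul_right ?_)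
  rw [heq, shiftProd_mul]
  exact (((shiftProd_dvd_of_subset hsub v').mul_left _).mul_right _).mul_right _

end Transfer

/-! ### Integer-linear polynomials -/

section IntegerLinear

variable {k : Type*} [Field k]

/-- `σ_x` on the polynomials in `y` over `k(x)`. -/
noncomputable def shiftX (k : Type*) [Field k] : (RatFunc k)[X] →+* (RatFunc k)[X] :=
  Polynomial.mapRingHom (shiftVar k)

/-- The inclusion of `k[x, y]` in `k(x)[y]`. -/
noncomputable def polyToRat (k : Type*) [Field k] : k[X][X] →+* (RatFunc k)[X] :=
  Polynomial.mapRingHom (algebraMap k[X] (RatFunc k))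

theorem polyToRat_injective : Function.Injective (polyToRat k) :=
  Polynomial.map_injective _ (RatFunc.algebraMap_injective k)

theorem shiftX_iterate_mul (n : ℕ) (p q : (RatFunc k)[X]) :
    (shiftX k)^[n] (p * q) = (shiftX k)^[n] p * (shiftX k)^[n] q :=
  iterate_map_mul (shiftX k) n p q

theorem shiftX_iterate_eq_map (n : ℕ) :
    ∃ φ : RatFunc k →+* RatFunc k, ∀ p : (RatFunc k)[X], (shiftX k)^[n] p = p.map φ := by
  induction n with
  | zero => exact ⟨RingHom.id _, fun p => by simp⟩
  | succ n ih =>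
    obtain ⟨φ, hφ⟩ := ih
    refine ⟨(shiftVar k).comp φ, fun p => ?_⟩
    rw [Function.iterate_succ_apply', hφ]
    simp [shiftX, Polynomial.map_map]

theorem shiftVar_C (c : k) : shiftVar k (RatFunc.C c) = RatFunc.C c := by
  simpa using shiftVar_algebraMap (C c)

theorem shiftVar_X : shiftVar k RatFunc.X = RatFunc.X + 1 := by
  simpa [shiftPow] using shiftVar_algebraMap (X : k[X])

theorem shiftX_polyToRat_aeval (P : k[X]) (l m j : ℤ) :
    shiftX k (polyToRat k (aeval ((l : k[X][X]) * C X + (m : k[X][X]) * X + (j : k[X][X])) P)) =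
      polyToRat k
        (aeval ((l : k[X][X]) * C X + (m : k[X][X]) * X + ((j + l : ℤ) : k[X][X])) P) := by
  induction P using Polynomial.induction_on' with
  | add p q hp hq => simp only [map_add, hp, hq]
  | monomial n c =>
    simp only [aeval_monomial, map_mul, map_pow]
    congr 1
    · simp [polyToRat, shiftX, shiftVar_C, Polynomial.algebraMap_apply]
    · simp only [polyToRat, shiftX, shiftVar_X, map_add, map_mul, map_intCast, coe_mapRingHom,
        map_C, map_X, RatFunc.algebraMap_X, Int.cast_add, map_one]
      ring

theorem shiftX_iterate_polyToRat_aeval (P : k[X]) (l m : ℤ) (i : ℕ) :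
    (shiftX k)^[i] (polyToRat k (aeval ((l : k[X][X]) * C X + (m : k[X][X]) * X) P)) =
      polyToRat k
        (aeval ((l : k[X][X]) * C X + (m : k[X][X]) * X + ((i * l : ℤ) : k[X][X])) P) := by
  induction i with
  | zero => simp
  | succ i ih =>
    rw [Function.iterate_succ_apply', ih, shiftX_polyToRat_aeval]
    congr 5
    push_cast
    ring

theorem shiftPow_polyToRat_aeval (P : k[X]) (l m j i : ℤ) :
    shiftPow i
      (polyToRat k (aeval ((l : k[X][X]) * C X + (m : k[X][X]) * X + (j : k[X][X])) P)) =
      polyToRat k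
        (aeval ((l : k[X][X]) * C X + (m : k[X][X]) * X + ((j + m * i : ℤ) : k[X][X])) P) := by
  change taylorAlgHom (i : RatFunc k) _ = _
  have hC (c : RatFunc k) : taylorAlgHom (i : RatFunc k) (C c) = C c := taylor_C _ c
  have hX : taylorAlgHom (i : RatFunc k) X = X + C (i : RatFunc k) := taylor_X _
  induction P using Polynomial.induction_on' with
  | add p q hp hq => simp only [map_add, hp, hq]
  | monomial n c =>
    simp only [aeval_monomial, map_mul, map_pow]
    congr 1
    · simp [polyToRat, Polynomial.algebraMap_apply, hC]
    · simp only [polyToRat, map_add, map_mul, map_intCast, coe_mapRingHom,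
        map_C, map_X, RatFunc.algebraMap_X, Int.cast_add, Int.cast_mul, hX, hC]
      ring

/-- All the images of an integer-linear polynomial under powers of `σ_x` divide products of
shifts with respect to `y` of one polynomial. -/
theorem IsPolyOfIntegerForm.exists_shiftDvd {p : k[X][X]} (hp : IsPolyOfIntegerForm p)
    (hp0 : p ≠ 0) :
    ∃ e : (RatFunc k)[X], e ≠ 0 ∧ ∀ i : ℕ, ShiftDvd ((shiftX k)^[i] (polyToRat k p)) e := by
  have hp0' : polyToRat k p ≠ 0 := (map_ne_zero_iff _ polyToRat_injective).2 hp0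
  have hne (i : ℕ) : (shiftX k)^[i] (polyToRat k p) ≠ 0 := by
    obtain ⟨φ, hφ⟩ := shiftX_iterate_eq_map (k := k) i
    rw [hφ]
    exact (Polynomial.map_ne_zero_iff φ.injective).2 hp0'
  obtain ⟨P, l, m, rfl⟩ := hp
  by_cases hm : m = 0
  · refine ⟨1, one_ne_zero, fun i => .of_isUnit ?_ _⟩
    obtain ⟨c, hc⟩ : ∃ c : RatFunc k,
        polyToRat k (aeval ((l : k[X][X]) * C X + (m : k[X][X]) * X) P) = C c := by
      refine ⟨algebraMap k[X] (RatFunc k) (aeval ((l : k[X]) * X) P), ?_⟩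
      have := aeval_algHom_apply (CAlgHom : k[X] →ₐ[k] k[X][X]) ((l : k[X]) * X) P
      simp only [map_mul, map_intCast, CAlgHom_apply] at this
      simp [hm, this, polyToRat]
    have := hne i
    obtain ⟨φ, hφ⟩ := shiftX_iterate_eq_map (k := k) i
    rw [hc, hφ, map_C] at this ⊢
    exact isUnit_C.2 (isUnit_iff_ne_zero.2 (C_ne_zero.1 this))
  · refine ⟨∏ r ∈ Finset.range m.natAbs,
      (shiftX k)^[r] (polyToRat k (aeval ((l : k[X][X]) * C X + (m : k[X][X]) * X) P)),
      Finset.prod_ne_zero_iff.2 fun r _ => hne r, fun i => ?_⟩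
    -- With `i = |m| t + r`, adding `i l` to the argument equals adding `r l` (by `σ_x^r`) and then
    -- `m (sign(m) t l)` (by a shift in `y`).
    refine .of_dvd_shiftPow (m.sign * (i / m.natAbs : ℕ) * l) ?_
    have hr : i % m.natAbs ∈ Finset.range m.natAbs :=
      Finset.mem_range.2 (Nat.mod_lt _ (Int.natAbs_pos.2 hm))
    convert shiftPow_dvd_shiftPow _ (Finset.dvd_prod_of_mem _ hr) using 1
    rw [shiftX_iterate_polyToRat_aeval, shiftX_iterate_polyToRat_aeval, shiftPow_polyToRat_aeval]
    congr 5
    have h1 : (i : ℤ) = m.natAbs * (i / m.natAbs : ℕ) + (i % m.natAbs : ℕ) := by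
      exact_mod_cast (Nat.div_add_mod i m.natAbs).symm
    have h2 : m * m.sign = m.natAbs := Int.mul_sign_self m
    linear_combination (l : ℤ) * h1 - ((i / m.natAbs : ℕ) : ℤ) * l * h2

theorem IsIntegerLinearPoly.exists_shiftDvd {p : k[X][X]} (hp : IsIntegerLinearPoly p)
    (hp0 : p ≠ 0) :
    ∃ e : (RatFunc k)[X], e ≠ 0 ∧ ∀ i : ℕ, ShiftDvd ((shiftX k)^[i] (polyToRat k p)) e := by
  induction p using WfDvdMonoid.induction_on_irreducible with
  | zero => exact absurd rfl hp0
  | unit p h =>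
    refine ⟨1, one_ne_zero, fun i => .of_isUnit ?_ _⟩
    obtain ⟨φ, hφ⟩ := shiftX_iterate_eq_map (k := k) i
    rw [hφ]
    exact (h.map (polyToRat k)).map (Polynomial.mapRingHom φ)
  | mul p f hp0' hf ih =>
    obtain ⟨e₁, h₁, h₁'⟩ := ih (fun g hg hgp => hp g hg (hgp.mul_left f)) hp0'
    obtain ⟨e₂, h₂, h₂'⟩ := (hp f hf (dvd_mul_right f p)).exists_shiftDvd hf.ne_zero
    refine ⟨e₂ * e₁, mul_ne_zero h₂ h₁, fun i => ?_⟩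
    rw [map_mul, shiftX_iterate_mul]
    exact (h₂' i).mul (h₁' i)

theorem IsIntegerLinear.exists_shiftDvd {b : (RatFunc k)[X]} (hb0 : b ≠ 0)
    (hb : IsIntegerLinear (algebraMap (RatFunc k)[X] (RatXY k) b)) :
    ∃ e : (RatFunc k)[X], e ≠ 0 ∧ ∀ i : ℕ, ShiftDvd ((shiftX k)^[i] b) e := by
  obtain ⟨n, d, hd, -, h, hn, -⟩ := hb
  have hpoly (p : k[X][X]) :
      polyToRatXY k p = algebraMap (RatFunc k)[X] (RatXY k) (polyToRat k p) := rfl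
  have hd' : polyToRat k d ≠ 0 := (map_ne_zero_iff _ polyToRat_injective).2 hd
  rw [hpoly, hpoly, eq_div_iff (algebraMap_ratFunc_ne_zero hd'), ← map_mul] at h
  have hbd : b * polyToRat k d = polyToRat k n := RatFunc.algebraMap_injective _ h
  have hn0 : n ≠ 0 := by
    rintro rfl
    rw [map_zero] at hbd
    exact mul_ne_zero hb0 hd' hbd
  obtain ⟨e, he, he'⟩ := hn.exists_shiftDvd hn0
  refine ⟨e, he, fun i => .of_dvd ?_ (he' i)⟩
  rw [← hbd, shiftX_iterate_mul]
  exact dvd_mul_right _ _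

end IntegerLinear


/-! ### Reduction of hypergeometric terms -/

section RationalFunctions

variable {k : Type*} [Field k]

theorem sigmaX_iterate_div (n : ℕ) (p q : (RatFunc k)[X]) :
    (sigmaX k)^[n] (algebraMap (RatFunc k)[X] (RatXY k) p / algebraMap (RatFunc k)[X] (RatXY k) q) =
      algebraMap (RatFunc k)[X] (RatXY k) ((shiftX k)^[n] p) /
        algebraMap (RatFunc k)[X] (RatXY k) ((shiftX k)^[n] q) := by
  induction n with
  | zero => rfl
  | succ n ih =>
    rw [Function.iterate_succ_apply', ih, Function.iterate_succ_apply',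
      Function.iterate_succ_apply', sigmaX, mapCoeff, RatFunc.coe_mapRingHom_eq_coe_map,
      RatFunc.map_apply_div]
    rfl

theorem IsShiftReduced.isCoprime_shiftPow {F : Type*} [Field F] {K : RatFunc F}
    (hK : IsShiftReduced K) {u v : F[X]} (hv : v ≠ 0) (huv : IsCoprime u v)
    (h : K = algebraMap F[X] (RatFunc F) u / algebraMap F[X] (RatFunc F) v) :
    u ≠ 0 ∧ ∀ i : ℤ, IsCoprime u (shiftPow i v) := by
  have heq : K.num * v = u * K.denom := (RatFunc.num_mul_eq_mul_denom_iff hv).2 h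
  refine ⟨?_, fun i => ?_⟩
  · rintro rfl
    exact hK.1 (by simpa using h)
  · have hu : u ∣ K.num := huv.dvd_of_dvd_mul_right (heq ▸ dvd_mul_right _ _)
    have hv' : v ∣ K.denom := huv.symm.dvd_of_dvd_mul_left (heq ▸ dvd_mul_left _ _)
    exact ((hK.2 i).of_isCoprime_of_dvd_left hu).of_isCoprime_of_dvd_right
      (shiftPow_dvd_shiftPow i hv')

end RationalFunctions

/-- A reducible rational function has a remainder in normal form. -/
theorem IsReducible.exists_normalForm {F : Type*} [Field F] {u v B : F[X]} (hv : v ≠ 0)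
    (hB : B ≠ 0) {f : RatFunc F} (hf : IsReducible u v B f) :
    ∃ (g : RatFunc F) (a q : F[X]), a.degree < B.degree ∧ q ∈ standardComplement u v ∧
      f = algebraMap F[X] (RatFunc F) u / algebraMap F[X] (RatFunc F) v * shiftVar F g - g +
        remainder v B a q := by
  obtain ⟨g, s, t, rfl⟩ := hf
  -- The polynomial part of `s/B` is put over `v`; then `φ_K(p)/v = K σ_y(p) - p` is absorbed.
  obtain ⟨p, q, hq, hpq⟩ := exists_phi_add_mem_standardComplement u v (t + s / B * v)
  refine ⟨g + algebraMap F[X] (RatFunc F) p, s % B, q, EuclideanDomain.mod_lt s hB, hq, ?_⟩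
  have h1 := congrArg (algebraMap F[X] (RatFunc F)) hpq
  have h2 := congrArg (algebraMap F[X] (RatFunc F)) (EuclideanDomain.div_add_mod s B)
  have hv' := algebraMap_ratFunc_ne_zero hv
  have hB' := algebraMap_ratFunc_ne_zero hB
  simp only [phi, map_add, map_sub, map_mul] at h1 h2
  simp only [remainder, map_add, shiftVar_algebraMap]
  field_simp
  linear_combination algebraMap F[X] (RatFunc F) B * h1 - algebraMap F[X] (RatFunc F) v * h2

namespace PartialDifferenceExtension

variable {k : Type*} [Field k] {D : Type*} [Ring D] (E : PartialDifferenceExtension k D)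

/-- `D` may have zero divisors, but nonzero elements of the field remain units in it. -/
theorem incl_mul_right_cancel {H : D} (hH : H ≠ 0) {f g : RatXY k}
    (h : E.incl f * H = E.incl g * H) : f = g := by
  by_contra hne
  have h1 : E.incl (f - g) * H = 0 := by rw [map_sub, sub_mul, h, sub_self]
  have h2 : E.incl ((f - g)⁻¹ * (f - g)) * H = 0 := by rw [map_mul, mul_assoc, h1, mul_zero]
  rw [inv_mul_cancel₀ (sub_ne_zero.2 hne), map_one, one_mul] at h2
  exact hH h2

theorem sx_iterate_incl_mul (n : ℕ) (f : RatXY k) (t : D) :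
    E.sx^[n] (E.incl f * t) = E.incl ((sigmaX k)^[n] f) * E.sx^[n] t := by
  induction n with
  | zero => rfl
  | succ n ih => simp only [Function.iterate_succ_apply', ih, map_mul, E.sx_incl]

theorem exists_sx_iterate_eq {H : D} (hH : E.IsHypergeometric H) (n : ℕ) :
    ∃ f : RatXY k, E.sx^[n] H = E.incl f * H := by
  obtain ⟨-, f, -, hf, -⟩ := hH
  induction n with
  | zero => exact ⟨1, by simp⟩
  | succ n ih =>
    obtain ⟨g, hg⟩ := ih
    exact ⟨sigmaX k g * f, by
      rw [Function.iterate_succ_apply', hg, map_mul, E.sx_incl, hf, map_mul, mul_assoc]⟩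

theorem sx_iterate_sy (n : ℕ) (t : D) : E.sx^[n] (E.sy t) = E.sy (E.sx^[n] t) :=
  (Function.Commute.iterate_left E.sx_sy n) t

theorem deltaY_incl_mul {H : D} {K : RatXY k} (hK : E.sy H = E.incl K * H) (g : RatXY k) :
    E.deltaY (E.incl g * H) = E.incl (K * sigmaY k g - g) * H := by
  rw [deltaY, map_mul, E.sy_incl, hK, ← mul_assoc, ← map_mul, ← sub_mul, ← map_sub, mul_comm K]

theorem sx_iterate_deltaY (n : ℕ) (t : D) : E.sx^[n] (E.deltaY t) = E.deltaY (E.sx^[n] t) := by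
  rw [deltaY, deltaY, iterate_map_sub, sx_iterate_sy]

/-- The ratios of `H` with respect to `σ_y` and `σ_x ^ n` are compatible. -/
theorem sigmaX_iterate_mul_eq {H : D} (hH : H ≠ 0) {K N : RatXY k} (hK : E.sy H = E.incl K * H)
    {n : ℕ} (hN : E.sx^[n] H = E.incl N * H) : (sigmaX k)^[n] K * N = sigmaY k N * K := by
  refine E.incl_mul_right_cancel hH ?_
  rw [map_mul, map_mul, mul_assoc, ← hN, ← sx_iterate_incl_mul, ← hK, sx_iterate_sy, hN, map_mul,
    E.sy_incl, hK, mul_assoc]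

/-- The denominators of the ratio of `σ_x ^ n (H)` and `H` and of `σ_x ^ n (K)` divide products
of shifts of `u` and `v` that do not depend on `n`. -/
theorem shiftDvd_denom [CharZero k] {H : D} (hH : H ≠ 0) {u v : (RatFunc k)[X]} (hu : u ≠ 0)
    (hv : v ≠ 0) (huv : ∀ i : ℤ, IsCoprime u (shiftPow i v))
    (hK : E.sy H = E.incl (algebraMap (RatFunc k)[X] (RatXY k) u /
      algebraMap (RatFunc k)[X] (RatXY k) v) * H)
    {N : RatXY k} (hN0 : N ≠ 0) {n : ℕ} (hN : E.sx^[n] H = E.incl N * H) :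
    ShiftDvd (N.denom * (shiftX k)^[n] v) (u * v * v) := by
  obtain ⟨φ, hφ⟩ := shiftX_iterate_eq_map (k := k) n
  have hu' : (shiftX k)^[n] u ≠ 0 := by
    rw [hφ]
    exact (Polynomial.map_ne_zero_iff φ.injective).2 hu
  have hv' : (shiftX k)^[n] v ≠ 0 := by
    rw [hφ]
    exact (Polynomial.map_ne_zero_iff φ.injective).2 hv
  have huv' (i : ℤ) : IsCoprime ((shiftX k)^[n] u) (shiftPow i ((shiftX k)^[n] v)) := by
    rw [hφ, hφ, ← map_shiftPow]
    exact (huv i).map (Polynomial.mapRingHom φ)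
  have h₁ : N.num ≠ 0 := RatFunc.num_ne_zero hN0
  have h₂ : N.denom ≠ 0 := N.denom_ne_zero
  have heq := E.sigmaX_iterate_mul_eq hH hK hN
  rw [sigmaX_iterate_div, ← RatFunc.num_div_denom N, sigmaY, shiftVar_div,
    div_mul_div_comm, div_mul_div_comm, div_eq_div_iff
      (mul_ne_zero (algebraMap_ratFunc_ne_zero hv') (algebraMap_ratFunc_ne_zero h₂))
      (mul_ne_zero (algebraMap_ratFunc_ne_zero (shiftPow_ne_zero h₂))
        (algebraMap_ratFunc_ne_zero hv))] at heq
  simp only [← map_mul] at heq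
  have hrel := RatFunc.algebraMap_injective _ heq
  have hden := shiftDvd_denom_of_shift_eq (r := (shiftX k)^[n] u * v) (s := u * (shiftX k)^[n] v)
    h₁ h₂ (by linear_combination hrel) N.isCoprime_num_denom
  have hvv := shiftProdDvd_of_shift_eq (v := v) (u := u) hv' huv' h₁ h₂
    (by linear_combination hrel)
  -- The same argument for the reciprocals of `K` and `N`, exchanging the roles of `u` and `v`.
  have huu := shiftProdDvd_of_shift_eq (v := u) (u := v) (u' := (shiftX k)^[n] v) hu'
    (fun i => by
      rw [← isCoprime_shiftPow_shiftPow (i := -i), shiftPow_shiftPow]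
      simpa using (huv' (-i)).symm) h₂ h₁ (by linear_combination -hrel)
  exact (hden.trans (huu.mul (.refl v))).mul hvv.shiftDvd

theorem hasRemainder_of_isReducible {H : D} {u v B : (RatFunc k)[X]} (hv : v ≠ 0) (hB : B ≠ 0)
    (hK : E.sy H = E.incl (algebraMap (RatFunc k)[X] (RatXY k) u /
      algebraMap (RatFunc k)[X] (RatXY k) v) * H) {f : RatXY k} (hf : IsReducible u v B f)
    (g : RatXY k) :
    ∃ a q : (RatFunc k)[X],
      E.HasRemainder H u v B (E.deltaY (E.incl g * H) + E.incl f * H) a q := by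
  obtain ⟨g', a, q, ha, hq, rfl⟩ := hf.exists_normalForm hv hB
  refine ⟨a, q, ha, hq, g + g', ?_⟩
  rw [E.deltaY_incl_mul hK, E.deltaY_incl_mul hK, ← add_mul, ← add_mul, ← map_add, ← map_add]
  congr 2
  rw [map_add, sigmaY]
  ring

end PartialDifferenceExtension

end HypergeomReduction

open HypergeomReduction in
theorem mainTheorem3 {k : Type*} [Field k] [CharZero k] {D : Type*} [Ring D]
    (E : HypergeomReduction.PartialDifferenceExtension k D)
    (T H : D) (hT : E.IsHypergeometric T) (hH : E.IsHypergeometric H)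
    (S K : HypergeomReduction.RatXY k) (hTSH : T = E.incl S * H)
    (hK : E.sy H = E.incl K * H) (hKred : HypergeomReduction.IsShiftReduced K)
    (u v : (RatFunc k)[X]) (hv : v ≠ 0) (huv : IsCoprime u v)
    (hKuv : K = algebraMap (RatFunc k)[X] (HypergeomReduction.RatXY k) u /
      algebraMap (RatFunc k)[X] (HypergeomReduction.RatXY k) v)
    (a b q : (RatFunc k)[X]) (hab : IsCoprime a b)
    (hbfree : HypergeomReduction.IsShiftFree b)
    (hbprime : HypergeomReduction.IsStronglyPrime u v b)
    (hred : E.HasRemainder H u v b T a q)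
    (hbint : HypergeomReduction.IsIntegerLinear
      (algebraMap (RatFunc k)[X] (HypergeomReduction.RatXY k) b)) :
    ∃ B : (RatFunc k)[X],
      HypergeomReduction.IsShiftFree B ∧ HypergeomReduction.IsStronglyPrime u v B ∧ b ∣ B ∧
      (∀ i : ℕ, ∃ a' q' : (RatFunc k)[X], E.HasRemainder H u v B (E.sx^[i] T) a' q') ∧
      (∀ a' q' : ℕ → (RatFunc k)[X],
        (∀ i : ℕ, E.HasRemainder H u v B (E.sx^[i] T) (a' i) (q' i)) →
        FiniteDimensional (RatFunc k) (Submodule.span (RatFunc k)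
          (Set.range fun i : ℕ => HypergeomReduction.remainder v B (a' i) (q' i)))) := by
  have : CharZero (RatFunc k) := charZero_of_injective_algebraMap
    (algebraMap k (RatFunc k)).injective
  obtain ⟨hu, huv'⟩ := hKred.isCoprime_shiftPow hv huv hKuv
  subst hKuv
  obtain ⟨e, he, he'⟩ := hbint.exists_shiftDvd hbprime.1
  obtain ⟨B, hBfree, hBprime, hbB, hB⟩ := exists_shiftFree_stronglyPrime_cover hu hv huv' hbfree
    hbprime (d := u * v * v * e) (mul_ne_zero (mul_ne_zero (mul_ne_zero hu hv) hv) he)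
  refine ⟨B, hBfree, hBprime, hbB, fun i => ?_, fun a' q' h =>
    finiteDimensional_span_remainder hu a' q' (fun i => (h i).1) (fun i => (h i).2.1)⟩
  obtain ⟨-, -, g, rfl⟩ := hred
  obtain ⟨N, hN⟩ := E.exists_sx_iterate_eq hH i
  rw [iterate_map_add, E.sx_iterate_deltaY, E.sx_iterate_incl_mul, E.sx_iterate_incl_mul, hN,
    ← mul_assoc, ← mul_assoc, ← map_mul, ← map_mul]
  refine E.hasRemainder_of_isReducible hv hBprime.1 hK ?_ _
  -- `σ_x` need not be injective on `D`, so `σ_x^i(H)` may vanish.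
  by_cases hN0 : N = 0
  · exact ⟨0, 0, 0, by simp [hN0, remainder]⟩
  have hdvd := ((E.shiftDvd_denom hH.1 hu hv huv' hK hN0 hN).mul (he' i)).trans hB
  obtain ⟨φ, hφ⟩ := shiftX_iterate_eq_map (k := k) i
  have hne {p : (RatFunc k)[X]} (hp : p ≠ 0) :
      algebraMap (RatFunc k)[X] (RatXY k) ((shiftX k)^[i] p) ≠ 0 := by
    rw [hφ]
    exact algebraMap_ratFunc_ne_zero ((Polynomial.map_ne_zero_iff φ.injective).2 hp)
  have hv' := hne hv
  have hb' := hne hbprime.1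
  have hd' := algebraMap_ratFunc_ne_zero N.denom_ne_zero
  convert hBprime.isReducibleDenom_of_shiftDvd hu hv hBfree hdvd
    (N.num * ((shiftX k)^[i] a * (shiftX k)^[i] v + (shiftX k)^[i] q * (shiftX k)^[i] b)) using 1
  rw [remainder, iterate_map_add, sigmaX_iterate_div, sigmaX_iterate_div]
  conv_lhs => rw [← RatFunc.num_div_denom N]
  simp only [map_mul, map_add]
  field_simp
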